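/- Let $F_0:\mathbb{R}\to\mathbb{R}$ be a continuous distribution function and let $X_1,X_2,\ldots$ be independent, identically distributed real random variables whose common distribution function $F$ equals $F_0$ (hypothesis $H_0$). For $n\ge 1$ let $X_{(1)}\le\cdots\le X_{(n)}$ denote the order statistics of $X_1,\ldots,X_n$, and for $1\le k<n$ put \[ R_{k,n}=\ln\bigl(1-F_0(X_{(n-k)})\bigr)-\frac1k\sum_{i=n-k+1}^{n}\ln\bigl(1-F_0(X_{(i)})\bigr). \] Then \[ \sqrt{k}\,(R_{k,n}-1)\xrightarrow{d}\xi\qquad\text{as } k,n\to\infty,\ k<n, \] where $\xi\sim N(0,1)$ is a standard normal random variable. -/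

import Mathlib

open MeasureTheory ProbabilityTheory Filter

/-- The `i`-th order statistic `x_{(i)}` of the sample `x`, with `1 ≤ i ≤ n`, so that
`x_{(1)} ≤ x_{(2)} ≤ ⋯ ≤ x_{(n)}`; the value `0` for `i` outside this range is never used. -/
noncomputable def orderStat {n : ℕ} (x : Fin n → ℝ) (i : ℕ) : ℝ :=
  if h : 1 ≤ i ∧ i ≤ n then x (Tuple.sort x ⟨i - 1, by omega⟩) else 0

/-- The Hill-type statistic
`R_{k,n} = ln (1 - F₀ (x_{(n-k)})) - (1/k) ∑_{i=n-k+1}^{n} ln (1 - F₀ (x_{(i)}))`,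
meaningful for `1 ≤ k < n`. -/
noncomputable def hillStat (F₀ : ℝ → ℝ) {n : ℕ} (x : Fin n → ℝ) (k : ℕ) : ℝ :=
  Real.log (1 - F₀ (orderStat x (n - k)))
    - (1 / (k : ℝ)) * ∑ i ∈ Finset.Icc (n - k + 1) n, Real.log (1 - F₀ (orderStat x i))

/-! By continuity of $F_0$, the variables $Y_j=-\ln(1-F_0(X_j))$ are independent standard
exponentials (`map_neg_log_one_sub_cdf`). Almost surely this transform preserves the order of the
sample, so $kR_{k,n}$ is the total excess $S$ of the $k$ largest $Y_j$ over the next one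
(`hillStat_eq_topExcess`). By Rényi's representation (`map_topExcess_eq_map_sum`), $S$ has the law
of a sum of $k$ independent standard exponentials, whatever $n>k$ is. The central limit theorem in
$k$ alone then gives the limit.

Rényi's representation is proved by characteristic functions: $e^{itS}$ is split according to which
observation is the threshold and which $k$ lie above it, and lack of memory yields a factor
$\varphi(t)^k$ times a constant free of $t$. -/

/-- The sum of the excesses of the `k` largest sample values over the `k + 1`-st largest one. -/
noncomputable def topExcess {n : ℕ} (y : Fin n → ℝ) (k : ℕ) : ℝ :=
  ∑ i ∈ Finset.Icc (n - k + 1) n, orderStat y i - k * orderStat y (n - k)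

/-! ### Order statistics and the total excess -/

lemma orderStat_of_mem {n : ℕ} (y : Fin n → ℝ) {i : ℕ} (h : 1 ≤ i ∧ i ≤ n) :
    orderStat y i = y (Tuple.sort y ⟨i - 1, by omega⟩) := dif_pos h

lemma orderStat_succ {n : ℕ} (y : Fin n → ℝ) (q : Fin n) :
    orderStat y (q + 1) = y (Tuple.sort y q) := by
  rw [orderStat_of_mem y ⟨by omega, by omega⟩]
  rfl

/-- Monotonicity is asked only on the sample: with `Real.log 0 = 0`, the map $-\ln(1-F_0)$ drops to
$0$ where $F_0=1$. -/
lemma orderStat_comp {n : ℕ} (x : Fin n → ℝ) {h : ℝ → ℝ} (hh : MonotoneOn h (Set.range x))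
    {i : ℕ} (hi : 1 ≤ i ∧ i ≤ n) : orderStat (h ∘ x) i = h (orderStat x i) := by
  have hm : Monotone ((h ∘ x) ∘ Tuple.sort x) := fun a b hab =>
    hh ⟨_, rfl⟩ ⟨_, rfl⟩ (Tuple.monotone_sort x hab)
  have := Tuple.unique_monotone (Tuple.monotone_sort (h ∘ x)) hm
  rw [orderStat_of_mem _ hi, orderStat_of_mem _ hi]
  exact congrFun this _

lemma sum_Icc_orderStat {n k : ℕ} (y : Fin n → ℝ) (p : Fin n) (hp : (p : ℕ) + k + 1 = n) :
    ∑ i ∈ Finset.Icc (n - k + 1) n, orderStat y i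
      = ∑ q ∈ Finset.Ioi p, y (Tuple.sort y q) := by
  symm
  refine Finset.sum_bij (fun q _ => (q : ℕ) + 1) ?_ ?_ ?_ ?_
  · intro q hq
    have := Finset.mem_Ioi.1 hq
    rw [Fin.lt_def] at this
    simp only [Finset.mem_Icc]
    omega
  · intro a _ b _ hab
    exact Fin.ext (by omega)
  · intro i hi
    rw [Finset.mem_Icc] at hi
    refine ⟨⟨i - 1, by omega⟩, ?_, ?_⟩
    · rw [Finset.mem_Ioi, Fin.lt_def]
      simp only
      omega
    · simp only
      omega
  · intro q _
    exact (orderStat_succ y q).symm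

lemma orderStat_sub_eq {n k : ℕ} (y : Fin n → ℝ) (p : Fin n) (hp : (p : ℕ) + k + 1 = n) :
    orderStat y (n - k) = y (Tuple.sort y p) := by
  rw [← orderStat_succ y p]
  congr 1
  omega

/-- Positive parts let the sum run over all indices, so the sorting permutation survives only in the
threshold. -/
lemma topExcess_eq_sum_max {n k : ℕ} (y : Fin n → ℝ) (p : Fin n) (hp : (p : ℕ) + k + 1 = n) :
    topExcess y k = ∑ i, max (y i - y (Tuple.sort y p)) 0 := by
  have hk : (k : ℝ) = ((Finset.Ioi p).card : ℝ) := by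
    rw [Fin.card_Ioi]
    congr 1
    omega
  rw [topExcess, sum_Icc_orderStat y p hp, orderStat_sub_eq y p hp, hk, ← nsmul_eq_mul,
    ← Finset.sum_const, ← Finset.sum_sub_distrib,
    ← Equiv.sum_comp (Tuple.sort y) (fun i => max (y i - y (Tuple.sort y p)) 0)]
  rw [← Finset.sum_subset (Finset.subset_univ (Finset.Ioi p))]
  · refine Finset.sum_congr rfl fun q hq => ?_
    have := Tuple.monotone_sort y (Finset.mem_Ioi.1 hq).le
    simp only [Function.comp] at this
    rw [max_eq_left (by linarith)]
  · intro q _ hq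
    have := Tuple.monotone_sort y (not_lt.1 (fun h => hq (Finset.mem_Ioi.2 h)))
    simp only [Function.comp] at this
    rw [max_eq_right (by linarith)]

lemma card_filter_gt {n : ℕ} {y : Fin n → ℝ} (hy : Function.Injective y) (q : Fin n) :
    (Finset.univ.filter fun i => y (Tuple.sort y q) < y i).card = n - 1 - q := by
  have hs : StrictMono (y ∘ Tuple.sort y) :=
    (Tuple.monotone_sort y).strictMono_of_injective (hy.comp (Tuple.sort y).injective)
  have : (Finset.univ.filter fun i => y (Tuple.sort y q) < y i)
      = (Finset.Ioi q).map (Tuple.sort y).toEmbedding := by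
    ext i
    obtain ⟨r, rfl⟩ := (Tuple.sort y).surjective i
    simp only [Finset.mem_filter, Finset.mem_univ, true_and, Finset.mem_map_equiv,
      Equiv.symm_apply_apply, Finset.mem_Ioi]
    exact hs.lt_iff_lt
  rw [this, Finset.card_map, Fin.card_Ioi]

lemma measurable_orderStat {n : ℕ} (i : ℕ) :
    Measurable fun y : Fin n → ℝ => orderStat y i := by
  by_cases h : 1 ≤ i ∧ i ≤ n
  · simp only [orderStat, dif_pos h]
    refine measurable_of_Iic fun a => ?_
    -- Counting the values at most `a` removes the sample-dependent permutation.
    have : (fun y : Fin n → ℝ => y (Tuple.sort y ⟨i - 1, by omega⟩)) ⁻¹' Set.Iic a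
        = {y | i - 1 < ∑ j, if y j ≤ a then 1 else 0} := by
      ext y
      have := Tuple.lt_card_le_iff_apply_le_of_monotone (j := ⟨i - 1, by omega⟩) (a := a)
        (Tuple.monotone_sort y)
      simp only [Function.comp] at this
      rw [Set.mem_preimage, Set.mem_Iic, ← this, Set.mem_ofPred_eq,
        ← Equiv.sum_comp (Tuple.sort y), Finset.card_filter]
    rw [this]
    refine measurableSet_lt measurable_const (Finset.measurable_sum _ fun j _ => ?_)
    exact Measurable.ite (measurableSet_le (measurable_pi_apply j) measurable_const)
      measurable_const measurable_const
  · simp only [orderStat, dif_neg h]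
    exact measurable_const

lemma measurable_topExcess {n : ℕ} (k : ℕ) :
    Measurable fun y : Fin n → ℝ => topExcess y k :=
  (Finset.measurable_sum _ fun i _ => measurable_orderStat i).sub
    ((measurable_orderStat _).const_mul _)

/-! ### Splitting the exponential of the excess -/

/-- The factor of `exp (i t S)`, `S` the sum of the excesses over a threshold `v`, that comes from
an observation `u`, on the event that `u` is above (`b = True`) or below (`b = False`) `v`. -/
noncomputable def excessFactor (t : ℝ) (b : Prop) [Decidable b] (u v : ℝ) : ℂ :=
  if b then (if v < u then Complex.exp (t * ((u - v : ℝ) : ℂ) * Complex.I) else 0)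
  else (if u < v then 1 else 0)

lemma norm_excessFactor_le (t : ℝ) (b : Prop) [Decidable b] (u v : ℝ) :
    ‖excessFactor t b u v‖ ≤ 1 := by
  unfold excessFactor
  split_ifs
  · rw [← Complex.ofReal_mul, Complex.norm_exp_ofReal_mul_I]
  all_goals simp

lemma measurable_excessFactor (t : ℝ) (b : Prop) [Decidable b] :
    Measurable fun z : ℝ × ℝ => excessFactor t b z.1 z.2 := by
  unfold excessFactor
  split_ifs
  · exact Measurable.ite (measurableSet_lt measurable_snd measurable_fst) (by fun_prop)
      measurable_const
  · exact Measurable.ite (measurableSet_lt measurable_fst measurable_snd) measurable_const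
      measurable_const

/-- Without ties a single term survives: `j` is the index with exactly `k` values above it, and `T`
marks those values among the other indices. -/
lemma sum_prod_excessFactor {m k : ℕ} (hk : k < m + 1) (t : ℝ) {y : Fin (m + 1) → ℝ}
    (hy : Function.Injective y) :
    ∑ j : Fin (m + 1), ∑ T ∈ Finset.powersetCard k (Finset.univ : Finset (Fin m)),
      ∏ i, excessFactor t (i ∈ T) (y (j.succAbove i)) (y j)
      = Complex.exp (t * (topExcess y k : ℂ) * Complex.I) := by
  have key (j : Fin (m + 1)) (T : Finset (Fin m))
      (hT : T ≠ Finset.univ.filter fun i => y j < y (j.succAbove i)) :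
      ∏ i, excessFactor t (i ∈ T) (y (j.succAbove i)) (y j) = 0 := by
    obtain ⟨i, hi⟩ : ∃ i, ¬ (i ∈ T ↔ y j < y (j.succAbove i)) := by
      by_contra! h
      exact hT (by ext i; simp [h i])
    refine Finset.prod_eq_zero (Finset.mem_univ i) ?_
    unfold excessFactor
    by_cases h1 : i ∈ T
    · rw [if_pos h1, if_neg (by tauto)]
    · have : y j < y (j.succAbove i) := by tauto
      rw [if_neg h1, if_neg this.not_gt]
  have hcard (j : Fin (m + 1)) :
      (Finset.univ.filter fun i => y j < y (j.succAbove i)).card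
        = (Finset.univ.filter fun i => y j < y i).card := by
    rw [Finset.card_filter, Finset.card_filter, Fin.sum_univ_succAbove _ j]
    simp
  let p : Fin (m + 1) := ⟨m - k, by omega⟩
  have hp : (p : ℕ) + k + 1 = m + 1 := by simp only [p]; omega
  rw [Finset.sum_eq_single (Tuple.sort y p)]
  · rw [Finset.sum_eq_single (Finset.univ.filter fun i =>
      y (Tuple.sort y p) < y ((Tuple.sort y p).succAbove i))]
    · rw [topExcess_eq_sum_max y p hp, Fin.sum_univ_succAbove _ (Tuple.sort y p), sub_self,
        max_self, zero_add, Complex.ofReal_sum, Finset.mul_sum, Finset.sum_mul, Complex.exp_sum]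
      refine Finset.prod_congr rfl fun i _ => ?_
      unfold excessFactor
      simp only [Finset.mem_filter, Finset.mem_univ, true_and]
      split_ifs with h1 h2
      · rw [max_eq_left (by linarith)]
      · rw [max_eq_right (by linarith)]
        simp
      · have := hy (le_antisymm (not_lt.1 h1) (not_lt.1 h2))
        exact absurd this (Fin.succAbove_ne _ _)
    · exact fun T _ hT => key _ T hT
    · intro h
      refine absurd ?_ h
      rw [Finset.mem_powersetCard]
      refine ⟨Finset.subset_univ _, ?_⟩
      rw [hcard, card_filter_gt hy]
      omega
  · intro j _ hj
    refine Finset.sum_eq_zero fun T hT => key j T ?_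
    rintro rfl
    have hc := (Finset.mem_powersetCard.1 hT).2
    obtain ⟨q, rfl⟩ := (Tuple.sort y).surjective j
    rw [hcard, card_filter_gt hy] at hc
    refine hj (congrArg _ (Fin.ext ?_))
    omega
  · exact fun h => absurd (Finset.mem_univ _) h

/-! ### The standard exponential law -/

instance isProbabilityMeasure_expMeasure_one : IsProbabilityMeasure (expMeasure 1) :=
  isProbabilityMeasure_expMeasure one_pos

lemma measurable_exponentialPDF_one : Measurable (exponentialPDF 1) :=
  (measurable_exponentialPDFReal 1).ennreal_ofReal

lemma integral_expMeasure_one {E : Type*} [NormedAddCommGroup E] [NormedSpace ℝ E] (f : ℝ → E) :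
    ∫ u, f u ∂expMeasure 1 = ∫ u in Set.Ioi 0, Real.exp (-u) • f u := by
  have h : expMeasure 1 = volume.withDensity (exponentialPDF 1) := rfl
  rw [h, integral_withDensity_eq_integral_toReal_smul
    measurable_exponentialPDF_one (by simp [exponentialPDF]),
    ← integral_Ici_eq_integral_Ioi, ← integral_indicator measurableSet_Ici]
  refine integral_congr_ae (Eventually.of_forall fun u => ?_)
  simp only [exponentialPDF_eq, Set.indicator, Set.mem_Ici]
  split_ifs with hu
  · rw [one_mul, one_mul, ENNReal.toReal_ofReal (Real.exp_pos _).le]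
  · simp

instance nullSingletonClass_expMeasure_one : NullSingletonClass (expMeasure 1) :=
  ⟨fun x => withDensity_absolutelyContinuous volume (exponentialPDF 1) (measure_singleton x)⟩

lemma ae_expMeasure_one_pos : ∀ᵐ u ∂expMeasure 1, 0 < u := by
  have h : expMeasure 1 = volume.withDensity (exponentialPDF 1) := rfl
  rw [h, ae_withDensity_iff measurable_exponentialPDF_one]
  filter_upwards [Measure.ae_ne volume (0 : ℝ)] with u hu h0
  by_contra hlt
  exact h0 (exponentialPDF_of_neg (lt_of_le_of_ne (not_lt.1 hlt) hu))

/-- The exponential distribution has no memory. -/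
lemma integral_excess_expMeasure_one (f : ℝ → ℂ) {v : ℝ} (hv : 0 ≤ v) :
    ∫ u, (if v < u then f (u - v) else 0) ∂expMeasure 1
      = Real.exp (-v) * ∫ u, f u ∂expMeasure 1 := by
  rw [integral_expMeasure_one, integral_expMeasure_one, ← integral_const_mul,
    ← integral_indicator measurableSet_Ioi, ← integral_indicator measurableSet_Ioi,
    ← integral_add_right_eq_self _ v]
  refine integral_congr_ae (Eventually.of_forall fun u => ?_)
  simp only [Set.indicator, Set.mem_Ioi, lt_add_iff_pos_left, add_sub_cancel_right]
  split_ifs with h1 h2 h2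
  · rw [Complex.real_smul, Complex.real_smul, ← mul_assoc, ← Complex.ofReal_mul, ← Real.exp_add]
    congr 3
    ring
  · simp
  · exact absurd (add_pos_of_pos_of_nonneg h2 hv) h1
  · simp

lemma integrable_expMeasure_one_iff {f : ℝ → ℝ} :
    Integrable f (expMeasure 1) ↔ IntegrableOn (fun u => Real.exp (-u) * f u) (Set.Ioi 0) := by
  have h : expMeasure 1 = volume.withDensity (exponentialPDF 1) := rfl
  rw [h, integrable_withDensity_iff_integrable_smul'
    measurable_exponentialPDF_one (by simp [exponentialPDF]),
    ← integrableOn_Ici_iff_integrableOn_Ioi, ← integrable_indicator_iff measurableSet_Ici]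
  refine integrable_congr (Eventually.of_forall fun u => ?_)
  simp only [exponentialPDF_eq, Set.indicator, Set.mem_Ici]
  split_ifs with hu
  · rw [one_mul, one_mul, ENNReal.toReal_ofReal (Real.exp_pos _).le, smul_eq_mul]
  · simp

lemma integral_pow_expMeasure_one (n : ℕ) : ∫ u, u ^ n ∂expMeasure 1 = n.factorial := by
  rw [integral_expMeasure_one, ← Real.Gamma_nat_eq_factorial, Real.Gamma_eq_integral (by positivity)]
  simp

lemma memLp_two_expMeasure_one : MemLp id 2 (expMeasure 1) := by
  rw [memLp_two_iff_integrable_sq measurable_id.aestronglyMeasurable,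
    integrable_expMeasure_one_iff]
  simpa using! Real.GammaIntegral_convergent (s := 3) (by norm_num) |>.congr_fun
    (g := fun u => Real.exp (-u) * u ^ 2) (fun u _ => by norm_num) measurableSet_Ioi

lemma variance_id_expMeasure_one : Var[id; expMeasure 1] = 1 := by
  rw [variance_eq_sub memLp_two_expMeasure_one]
  have h1 := integral_pow_expMeasure_one 1
  have h2 := integral_pow_expMeasure_one 2
  simp only [pow_one] at h1
  simp only [id, Pi.pow_apply, h1, h2]
  norm_num

lemma cdf_expMeasure_one (x : ℝ) :
    cdf (expMeasure 1) x = if 0 ≤ x then 1 - Real.exp (-x) else 0 := by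
  rw [cdf_expMeasure_eq one_pos, one_mul]

/-! ### Reduction to exponential variables -/

/-- The probability integral transform, at levels in `(0, 1)`, for a continuous distribution
function. -/
lemma measureReal_cdf_le {μ : Measure ℝ} [IsProbabilityMeasure μ] (hc : Continuous (cdf μ))
    {u : ℝ} (h0 : 0 ≤ u) (h1 : u < 1) : μ.real {x | cdf μ x ≤ u} = u := by
  have hex {v : ℝ} (hv0 : 0 < v) (hv1 : v < 1) : ∃ x, cdf μ x = v := by
    obtain ⟨a, ha⟩ := ((tendsto_cdf_atBot μ).eventually (gt_mem_nhds hv0)).exists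
    obtain ⟨b, hb⟩ := ((tendsto_cdf_atTop μ).eventually (lt_mem_nhds hv1)).exists
    exact mem_range_of_exists_le_of_exists_ge hc ⟨a, ha.le⟩ ⟨b, hb.le⟩
  -- The distribution function may stay at level `u` on an interval, so the upper bound goes through
  -- levels `v > u`.
  refine le_antisymm (le_of_forall_gt_imp_ge_of_dense fun v hv => ?_) ?_
  · rcases lt_or_ge v 1 with hv1 | hv1
    · obtain ⟨x, hx⟩ := hex (h0.trans_lt hv) hv1
      rw [← hx, cdf_eq_real]
      refine measureReal_mono fun z (hz : cdf μ z ≤ u) => ?_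
      by_contra hzx
      have := monotone_cdf μ (not_le.1 hzx).le
      linarith
    · exact measureReal_le_one.trans hv1
  · rcases h0.eq_or_lt with rfl | h0
    · exact measureReal_nonneg
    · obtain ⟨x, hx⟩ := hex h0 h1
      nth_rw 1 [← hx, cdf_eq_real]
      exact measureReal_mono fun z hz => (monotone_cdf μ hz).trans hx.le

/-- The event contains $\{F\le u\}$, of probability $u$, for every $u\in[0,1)$. -/
lemma ae_cdf_lt_one {μ : Measure ℝ} [IsProbabilityMeasure μ] (hc : Continuous (cdf μ)) :
    ∀ᵐ x ∂μ, cdf μ x < 1 := by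
  have hm : MeasurableSet {x | cdf μ x < 1} := measurableSet_lt hc.measurable measurable_const
  have h1 : μ.real {x | cdf μ x < 1} = 1 := by
    refine le_antisymm measureReal_le_one (le_of_forall_lt_imp_le_of_dense fun u hu => ?_)
    rcases le_or_gt 0 u with h0 | h0
    · nth_rw 1 [← measureReal_cdf_le hc h0 hu]
      exact measureReal_mono fun x hx => lt_of_le_of_lt hx hu
    · exact h0.le.trans measureReal_nonneg
  exact (prob_compl_eq_zero_iff hm).2 (by
    rw [← ENNReal.toReal_eq_one_iff, ← measureReal_def, h1])

lemma map_neg_log_one_sub_cdf {μ : Measure ℝ} [IsProbabilityMeasure μ] (hc : Continuous (cdf μ)) :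
    μ.map (fun x => -Real.log (1 - cdf μ x)) = expMeasure 1 := by
  have hm : Measurable fun x => -Real.log (1 - cdf μ x) :=
    (Real.measurable_log.comp (measurable_const.sub hc.measurable)).neg
  have := Measure.isProbabilityMeasure_map (μ := μ) hm.aemeasurable
  refine Measure.eq_of_cdf _ _ (StieltjesFunction.ext fun y => ?_)
  rw [cdf_expMeasure_one, cdf_eq_real, map_measureReal_apply hm measurableSet_Iic]
  split_ifs with hy
  · rw [← measureReal_cdf_le hc (u := 1 - Real.exp (-y)) (by simpa using hy)
      (by simpa using Real.exp_pos _)]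
    refine measureReal_congr ?_
    filter_upwards [ae_cdf_lt_one hc] with x hx
    refine propext ?_
    change -Real.log (1 - cdf μ x) ≤ y ↔ cdf μ x ≤ 1 - Real.exp (-y)
    rw [neg_le, Real.le_log_iff_exp_le (by linarith)]
    constructor <;> intro h <;> linarith
  · convert measureReal_empty
    refine Set.eq_empty_of_forall_notMem fun x hx => hy (le_trans ?_ hx)
    exact neg_nonneg.2 (Real.log_nonpos (by linarith [cdf_le_one μ x]) (by linarith [cdf_nonneg μ x]))

/-! ### Rényi's representation -/

lemma integral_excessFactor (t : ℝ) (b : Prop) [Decidable b] {v : ℝ} (hv : 0 ≤ v) :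
    ∫ u, excessFactor t b u v ∂expMeasure 1
      = (if b then charFun (expMeasure 1) t else 1)
        * (if b then (Real.exp (-v) : ℂ) else (expMeasure 1).real (Set.Iio v)) := by
  unfold excessFactor
  split_ifs
  · rw [integral_excess_expMeasure_one (fun u => Complex.exp (t * (u : ℂ) * Complex.I)) hv,
      charFun_apply_real, mul_comm]
  · rw [one_mul, ← integral_indicator_one measurableSet_Iio, ← integral_complex_ofReal]
    refine integral_congr_ae (Eventually.of_forall fun u => ?_)
    by_cases h : u < v <;> simp [Set.indicator, h]

lemma measurable_prod_excessFactor {m : ℕ} (t : ℝ) (j : Fin (m + 1)) (T : Finset (Fin m)) :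
    Measurable fun y : Fin (m + 1) → ℝ =>
      ∏ i, excessFactor t (i ∈ T) (y (j.succAbove i)) (y j) :=
  Finset.measurable_fun_prod _ fun i _ => (measurable_excessFactor t (i ∈ T)).comp
    (g := fun z : ℝ × ℝ => excessFactor t (i ∈ T) z.1 z.2)
    (f := fun y : Fin (m + 1) → ℝ => (y (j.succAbove i), y j))
    ((measurable_pi_apply _).prodMk (measurable_pi_apply _))

lemma norm_prod_excessFactor_le {m : ℕ} (t : ℝ) (j : Fin (m + 1)) (T : Finset (Fin m))
    (y : Fin (m + 1) → ℝ) : ‖∏ i, excessFactor t (i ∈ T) (y (j.succAbove i)) (y j)‖ ≤ 1 := by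
  rw [norm_prod]
  exact Finset.prod_le_one (fun _ _ => norm_nonneg _) fun _ _ => norm_excessFactor_le ..

lemma integrable_prod_excessFactor {m : ℕ} (t : ℝ) (j : Fin (m + 1)) (T : Finset (Fin m)) :
    Integrable (fun y : Fin (m + 1) → ℝ =>
      ∏ i, excessFactor t (i ∈ T) (y (j.succAbove i)) (y j))
      (Measure.pi fun _ => expMeasure 1) :=
  .of_bound (measurable_prod_excessFactor t j T).aestronglyMeasurable 1
    (Eventually.of_forall (norm_prod_excessFactor_le t j T))

/-- Given the threshold $v=y_j$, the other coordinates integrate separately, and each index in `T`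
contributes $\varphi(t)e^{-v}$. The point is that `C` is independent of `t`; its value is never
needed. -/
lemma exists_integral_prod_excessFactor {m : ℕ} (j : Fin (m + 1)) (T : Finset (Fin m)) :
    ∃ C : ℂ, ∀ t : ℝ,
      ∫ y, ∏ i, excessFactor t (i ∈ T) (y (j.succAbove i)) (y j)
        ∂(Measure.pi fun _ : Fin (m + 1) => expMeasure 1)
      = charFun (expMeasure 1) t ^ T.card * C := by
  refine ⟨∫ v, ∏ i : Fin m, (if i ∈ T then (Real.exp (-v) : ℂ)
    else (expMeasure 1).real (Set.Iio v)) ∂expMeasure 1, fun t => ?_⟩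
  have hmp := (measurePreserving_piFinSuccAbove (fun _ : Fin (m + 1) => expMeasure 1) j).symm
  have hint := (hmp.integrable_comp_emb (MeasurableEquiv.measurableEmbedding _)).2
    (integrable_prod_excessFactor t j T)
  simp only [Function.comp_def] at hint
  rw [← hmp.integral_comp', integral_prod _ hint, ← integral_const_mul]
  refine integral_congr_ae ?_
  filter_upwards [ae_expMeasure_one_pos] with v hv
  simp only [MeasurableEquiv.piFinSuccAbove_symm_apply, Fin.insertNthEquiv_apply,
    Fin.insertNth_apply_succAbove, Fin.insertNth_apply_same]
  rw [integral_fintype_prod_eq_prod (fun i u => excessFactor t (i ∈ T) u v)]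
  simp_rw [integral_excessFactor t _ hv.le, Finset.prod_mul_distrib]
  congr 1
  rw [Finset.prod_ite_mem, Finset.univ_inter, Finset.prod_const]

lemma ae_pi_injective {n : ℕ} (μ : Measure ℝ) [IsProbabilityMeasure μ] [NullSingletonClass μ] :
    ∀ᵐ y ∂(Measure.pi fun _ : Fin n => μ), Function.Injective y := by
  have h (i j : Fin n) (hij : i ≠ j) : ∀ᵐ y ∂(Measure.pi fun _ : Fin n => μ), y i ≠ y j := by
    have hind : IndepFun (fun y : Fin n → ℝ => y i) (fun y => y j) (Measure.pi fun _ => μ) :=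
      (iIndepFun_pi (μ := fun _ : Fin n => μ) (X := fun _ => id)
        (fun _ => aemeasurable_id)).indepFun hij
    have hmap := (indepFun_iff_map_prod_eq_prod_map_map (measurable_pi_apply i).aemeasurable
      (measurable_pi_apply j).aemeasurable).1 hind
    rw [(measurePreserving_eval (fun _ : Fin n => μ) i).map_eq,
      (measurePreserving_eval (fun _ : Fin n => μ) j).map_eq] at hmap
    have hdiag : ∀ᵐ z ∂(μ.prod μ), z.1 ≠ z.2 := by
      rw [Measure.ae_prod_iff_ae_ae (p := fun z : ℝ × ℝ => z.1 ≠ z.2)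
        (measurableSet_eq_fun measurable_fst measurable_snd).compl]
      refine Eventually.of_forall fun x => ?_
      filter_upwards [Measure.ae_ne μ x] with y hy
      exact hy.symm
    rw [← hmap] at hdiag
    exact ae_of_ae_map (f := fun y : Fin n → ℝ => (y i, y j)) (p := fun z => z.1 ≠ z.2)
      (by fun_prop) hdiag
  have hall : ∀ᵐ y ∂(Measure.pi fun _ : Fin n => μ), ∀ i j, i ≠ j → y i ≠ y j := by
    simp only [ae_all_iff]
    exact h
  filter_upwards [hall] with y hy i j hij
  by_contra hne
  exact hy i j hne hij

lemma charFun_map_topExcess {n k : ℕ} (hk : k < n) (t : ℝ) :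
    charFun ((Measure.pi fun _ : Fin n => expMeasure 1).map fun y => topExcess y k) t
      = charFun (expMeasure 1) t ^ k := by
  obtain ⟨m, rfl⟩ : ∃ m, n = m + 1 := ⟨n - 1, by omega⟩
  choose C hC using exists_integral_prod_excessFactor (m := m)
  have key (s : ℝ) :
      charFun ((Measure.pi fun _ : Fin (m + 1) => expMeasure 1).map fun y => topExcess y k) s
        = charFun (expMeasure 1) s ^ k
          * ∑ j, ∑ T ∈ Finset.powersetCard k (Finset.univ : Finset (Fin m)), C j T := by
    rw [charFun_apply_real, integral_map (measurable_topExcess k).aemeasurable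
      (by fun_prop)]
    calc _ = ∫ y, ∑ j : Fin (m + 1), ∑ T ∈ Finset.powersetCard k (Finset.univ : Finset (Fin m)),
            ∏ i, excessFactor s (i ∈ T) (y (j.succAbove i)) (y j)
            ∂(Measure.pi fun _ : Fin (m + 1) => expMeasure 1) := by
          refine integral_congr_ae ?_
          filter_upwards [ae_pi_injective (expMeasure 1)] with y hy
          exact (sum_prod_excessFactor hk s hy).symm
      _ = _ := by
          rw [integral_finsetSum _ fun j _ => integrable_finsetSum _ fun T _ =>
            integrable_prod_excessFactor s j T, Finset.mul_sum]
          refine Finset.sum_congr rfl fun j _ => ?_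
          rw [integral_finsetSum _ fun T _ => integrable_prod_excessFactor s j T, Finset.mul_sum]
          refine Finset.sum_congr rfl fun T hT => ?_
          rw [hC, (Finset.mem_powersetCard.1 hT).2]
  have := Measure.isProbabilityMeasure_map
    (μ := Measure.pi fun _ : Fin (m + 1) => expMeasure 1) (measurable_topExcess k).aemeasurable
  -- A characteristic function is $1$ at $0$, so the constants sum to $1$.
  have h0 := key 0
  simp only [charFun_zero, probReal_univ, Complex.ofReal_one, one_pow, one_mul] at h0
  rw [key, ← h0, mul_one]

/-- **Rényi's representation** of the total excess of the `k` largest of `n` independent standard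
exponential variables: it is distributed as the sum of `k` of them. -/
lemma map_topExcess_eq_map_sum {Ω : Type*} [MeasurableSpace Ω] {P : Measure Ω}
    [IsProbabilityMeasure P] {Y : ℕ → Ω → ℝ} (hY : ∀ j, Measurable (Y j)) (hindep : iIndepFun Y P)
    (hlaw : ∀ j, P.map (Y j) = expMeasure 1) {n k : ℕ} (hk : k < n) :
    P.map (fun ω => topExcess (fun j : Fin n => Y j ω) k)
      = P.map (fun ω => ∑ j ∈ Finset.range k, Y j ω) := by
  have hpi : P.map (fun ω (j : Fin n) => Y j ω) = Measure.pi fun _ : Fin n => expMeasure 1 := by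
    rw [(iIndepFun_iff_map_fun_eq_pi_map fun j : Fin n => (hY j).aemeasurable).1
      (hindep.precomp Fin.val_injective)]
    simp only [hlaw]
  have hS : P.map (fun ω => topExcess (fun j : Fin n => Y j ω) k)
      = (Measure.pi fun _ : Fin n => expMeasure 1).map fun y => topExcess y k := by
    rw [← hpi, Measure.map_map (measurable_topExcess k) (measurable_pi_lambda _ fun j => hY j)]
    rfl
  have hm : Measurable fun ω => ∑ j ∈ Finset.range k, Y j ω :=
    Finset.measurable_sum _ fun j _ => hY j
  have := Measure.isProbabilityMeasure_map (μ := P) hm.aemeasurable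
  have := Measure.isProbabilityMeasure_map
    (μ := Measure.pi fun _ : Fin n => expMeasure 1) (measurable_topExcess k).aemeasurable
  rw [hS]
  refine Measure.ext_of_charFun (funext fun t => ?_)
  rw [charFun_map_topExcess hk, (hindep.restrict _).charFun_map_fun_finsetSum_eq_prod
    fun j _ => (hY j).aemeasurable]
  simp [hlaw]

/-! ### The Hill-type statistic and its limit -/

lemma measurable_hillStat {F₀ : ℝ → ℝ} (hF₀ : Measurable F₀) {n : ℕ} (k : ℕ) :
    Measurable fun x : Fin n → ℝ => hillStat F₀ x k := by
  have h (i : ℕ) : Measurable fun x : Fin n → ℝ => Real.log (1 - F₀ (orderStat x i)) :=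
    Real.measurable_log.comp (measurable_const.sub (hF₀.comp (measurable_orderStat i)))
  exact (h _).sub ((Finset.measurable_sum _ fun i _ => h i).const_mul _)

lemma hillStat_eq_topExcess {F₀ : ℝ → ℝ} (hF₀ : Monotone F₀) {n k : ℕ} (hk0 : 0 < k) (hk : k < n)
    (x : Fin n → ℝ) (hx : ∀ i, F₀ (x i) < 1) :
    hillStat F₀ x k = (k : ℝ)⁻¹ * topExcess (fun i => -Real.log (1 - F₀ (x i))) k := by
  have hm : MonotoneOn (fun z => -Real.log (1 - F₀ z)) (Set.range x) := by
    rintro _ ⟨i, rfl⟩ _ ⟨j, rfl⟩ hij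
    have := hF₀ hij
    exact neg_le_neg (Real.log_le_log (by linarith [hx j]) (by linarith))
  have hc {i : ℕ} (hi : 1 ≤ i ∧ i ≤ n) := orderStat_comp x hm hi
  have hk' : (k : ℝ) ≠ 0 := by positivity
  change _ = (k : ℝ)⁻¹ * topExcess ((fun z => -Real.log (1 - F₀ z)) ∘ x) k
  rw [hillStat, topExcess, hc (by omega), Finset.sum_congr rfl fun i hi => hc (i := i) (by
    rw [Finset.mem_Icc] at hi; omega), Finset.sum_neg_distrib]
  field_simp
  ring

/-- `X 0, X 1, …` are i.i.d. with the continuous distribution function `F₀`, the sample of size `n`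
is `X 0, …, X (n - 1)`, and the limit is taken over all pairs `(k, n)` with `k < n` as both
`k` and `n` tend to infinity. -/
theorem theorem1 {Ω Ω' : Type*} [MeasurableSpace Ω] [MeasurableSpace Ω']
    (P : Measure Ω) [IsProbabilityMeasure P] (P' : Measure Ω') [IsProbabilityMeasure P']
    (F₀ : ℝ → ℝ) (hF₀ : Continuous F₀)
    (X : ℕ → Ω → ℝ) (hX : ∀ j, Measurable (X j)) (hindep : iIndepFun X P)
    (hH₀ : ∀ j x, cdf (P.map (X j)) x = F₀ x)
    (ξ : Ω' → ℝ) (hξ : HasLaw ξ (gaussianReal 0 1) P') :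
    TendstoInDistribution
      (fun (p : ℕ × ℕ) (ω : Ω) =>
        √(p.1 : ℝ) * (hillStat F₀ (fun j : Fin p.2 => X j ω) p.1 - 1))
      ((atTop ×ˢ atTop) ⊓ 𝓟 {p : ℕ × ℕ | p.1 < p.2}) ξ (fun _ => P) P' := by
  have hprob (j : ℕ) : IsProbabilityMeasure (P.map (X j)) :=
    Measure.isProbabilityMeasure_map (hX j).aemeasurable
  have hcdf (j : ℕ) : ⇑(cdf (P.map (X j))) = F₀ := funext (hH₀ j)
  have hg : Measurable fun z => -Real.log (1 - F₀ z) :=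
    (Real.measurable_log.comp (measurable_const.sub hF₀.measurable)).neg
  set Y : ℕ → Ω → ℝ := fun j ω => -Real.log (1 - F₀ (X j ω)) with hYdef
  have hY (j : ℕ) : Measurable (Y j) := hg.comp (hX j)
  have hYindep : iIndepFun Y P := hindep.comp (fun _ => fun z => -Real.log (1 - F₀ z)) fun _ => hg
  have hYlaw (j : ℕ) : P.map (Y j) = expMeasure 1 := by
    have := map_neg_log_one_sub_cdf (μ := P.map (X j)) (by rw [hcdf]; exact hF₀)
    rwa [hcdf, Measure.map_map hg (hX j)] at this
  have hlt : ∀ᵐ ω ∂P, ∀ j, F₀ (X j ω) < 1 := by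
    refine ae_all_iff.2 fun j => ?_
    have := ae_cdf_lt_one (μ := P.map (X j)) (by rw [hcdf]; exact hF₀)
    rw [hcdf] at this
    exact ae_of_ae_map (hX j).aemeasurable this
  have hlaw0 : HasLaw (Y 0) (expMeasure 1) P := ⟨(hY 0).aemeasurable, hYlaw 0⟩
  have hmean : P[Y 0] = 1 := by
    rw [hlaw0.integral_eq]
    simpa using integral_pow_expMeasure_one 1
  have hvar : Var[Y 0; P] = 1 := by
    rw [hlaw0.variance_eq, variance_id_expMeasure_one]
  have hmem : MemLp (Y 0) 2 P := by
    have h := memLp_two_expMeasure_one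
    rw [← hYlaw 0] at h
    exact (memLp_map_measure_iff measurable_id.aestronglyMeasurable (hY 0).aemeasurable).1 h
  have hclt := tendstoInDistribution_inv_sqrt_mul_sum_sub (Y := ξ) (P' := P')
    (by rwa [hvar, Real.toNNReal_one]) hmem hYindep
    fun j => ⟨(hY j).aemeasurable, (hY 0).aemeasurable, by rw [hYlaw, hYlaw]⟩
  have hmeas (p : ℕ × ℕ) : Measurable fun ω =>
      √(p.1 : ℝ) * (hillStat F₀ (fun j : Fin p.2 => X j ω) p.1 - 1) :=
    (((measurable_hillStat hF₀.measurable p.1).comp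
      (measurable_pi_lambda _ fun j => hX j)).sub_const 1).const_mul _
  refine ⟨fun p => (hmeas p).aemeasurable, hclt.aemeasurable_limit, ?_⟩
  have hfst : Tendsto Prod.fst ((atTop ×ˢ atTop) ⊓ 𝓟 {p : ℕ × ℕ | p.1 < p.2}) atTop :=
    tendsto_fst.mono_left inf_le_left
  -- Once $0<k<n$ the law depends on $k$ only, so the limit over pairs is the limit in $k$.
  refine (hclt.tendsto.comp hfst).congr' ?_
  filter_upwards [hfst.eventually (eventually_gt_atTop 0),
    mem_inf_of_right (mem_principal_self {p : ℕ × ℕ | p.1 < p.2})] with p hp0 hp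
  refine Subtype.ext ?_
  simp only [hmean, mul_one]
  -- The normalisation is $\sqrt k\,(s/k-1)=(s-k)/\sqrt k$.
  have hφ : Measurable fun s : ℝ => (√(p.1 : ℝ))⁻¹ * (s - p.1) := by fun_prop
  have hsum : Measurable fun ω => ∑ j ∈ Finset.range p.1, Y j ω :=
    Finset.measurable_sum _ fun j _ => hY j
  have htop : Measurable fun ω => topExcess (fun j : Fin p.2 => Y j ω) p.1 :=
    (measurable_topExcess p.1).comp (measurable_pi_lambda _ fun j => hY j)
  have h1 := Measure.map_map (μ := P) hφ hsum
  have h2 := Measure.map_map (μ := P) hφ htop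
  rw [map_topExcess_eq_map_sum hY hYindep hYlaw hp, h1] at h2
  refine h2.trans (Measure.map_congr ?_)
  filter_upwards [hlt] with ω hω
  have hmono : Monotone F₀ := hcdf 0 ▸ monotone_cdf _
  simp only [Function.comp_apply]
  rw [hillStat_eq_topExcess hmono hp0 hp _ fun i => hω i]
  have hpos : (0 : ℝ) < p.1 := by exact_mod_cast hp0
  have hs := Real.sqrt_pos.2 hpos
  have hsq := Real.mul_self_sqrt hpos.le
  field_simp
  rw [Real.sq_sqrt hpos.le]
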